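/- Let $S$ be a set of $n>3$ points in the plane in general position, i.e. no three points of $S$ are collinear and no four are cocircular. Let $\overline{cr}(S)$ be the rectilinear crossing number of $S$, that is, the number of pairs of crossing edges of the complete graph drawn with straight-line segments on the vertex set $S$, and write $\overline{cr}(S)=\alpha\binom{n}{4}$. For $j\ge 0$ let $e_j$ be the number of oriented $j$-edges of $S$, i.e. of directed straight lines through two points of $S$ such that the open half-plane to the right of the line contains exactly $j$ points of $S$, and let $E_{\le k}=\sum_{j=0}^{k}e_j$. Then the polynomial $$p_E(z)=\sum_{k=0}^{n-3}E_{\le k}\,z^k$$ has a (complex) root of modulus at least $\dfrac{3+\alpha}{9-\alpha}$. -/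

import Mathlib

open Polynomial

noncomputable section

/-- A finite set of points of the plane (identified with `ℂ`) is in general position if no three of
its points are collinear and no four of its points are cocircular. -/
def InGeneralPosition (S : Finset ℂ) : Prop :=
  (∀ T ⊆ S, T.card = 3 → ¬ Collinear ℝ (T : Set ℂ)) ∧
  (∀ T ⊆ S, T.card = 4 → ¬ EuclideanGeometry.Cospherical (T : Set ℂ))

/-- Two edges of the complete straight-line graph, given by their sets of endpoints, cross if they
have no common endpoint and the segments they span meet. -/
def EdgesCross (e f : Finset ℂ) : Prop :=
  Disjoint e f ∧ (convexHull ℝ (e : Set ℂ) ∩ convexHull ℝ (f : Set ℂ)).Nonempty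

open Classical in
/-- The rectilinear crossing number of `S`: the number of unordered pairs `{e, f}` of crossing edges
of the complete graph drawn with straight-line segments on the vertex set `S`. -/
def rectilinearCr (S : Finset ℂ) : ℕ :=
  (((S.powersetCard 2).powersetCard 2).filter fun P =>
    (P : Set (Finset ℂ)).Pairwise EdgesCross).card

/-- The point `r` lies in the open half-plane to the right of the line through `p` and `q`,
directed from `p` to `q`. -/
def IsRightOf (p q r : ℂ) : Prop :=
  (q - p).re * (r - p).im - (q - p).im * (r - p).re < 0

open Classical in
/-- The number `e_j` of (oriented) `j`-edges of `S`. When no three points of `S` are collinear, the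
directed lines through two points of `S` correspond to the ordered pairs of distinct points. -/
def numJEdges (S : Finset ℂ) (j : ℕ) : ℕ :=
  (S.offDiag.filter fun pq => (S.filter fun r => IsRightOf pq.1 pq.2 r).card = j).card

/-- The number `E_{≤ k}` of `(≤ k)`-edges of `S`. -/
def numAtMostKEdges (S : Finset ℂ) (k : ℕ) : ℕ :=
  ∑ j ∈ Finset.range (k + 1), numJEdges S j

/-- The `E_{≤ k}` polynomial `∑_{k = 0}^{n - 3} E_{≤ k} z ^ k` of a set `S` of `n ≥ 3` points. -/
def edgePolynomial (S : Finset ℂ) : ℂ[X] :=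
  ∑ k ∈ Finset.range (S.card - 2), C (numAtMostKEdges S k : ℂ) * X ^ k

end

/-! For roots `z` of `p`, `p'(1)/p(1)` is the sum of `1/(1 - z)`. If all roots had modulus below `r
≤ 1`, each term would have real part above `1/(1 + r)` (`exists_root_le_norm`), so it suffices to
compute `p(1)` and `p'(1)`. An ordered pair with `r` points to its right and `l` to its left
contributes to `E_{≤k}` exactly for `r ≤ k < r + l = n - 2`. Hence `p(1)` is the sum of the `l`, and
`2p'(1) = (n - 3)p(1) + R` with `R` the sum of the `r * l`. `R` encodes the crossing number: four
points in convex position have two separating lines and one crossing, otherwise three and none. So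
separations plus crossings make three per quadruple, giving `R + 2 cr = 6 C(n,4)`. Then `p'(1) /
(p(1) deg p) = (9 - α)/12`, which is `1/(1 + r)` for the stated bound `r`. -/

/-- Twice the signed area of the triangle `pqr`. -/
def orientDet (p q r : ℂ) : ℝ :=
  (q - p).re * (r - p).im - (q - p).im * (r - p).re

theorem isRightOf_iff_orientDet_neg (p q r : ℂ) : IsRightOf p q r ↔ orientDet p q r < 0 :=
  Iff.rfl

theorem orientDet_swap (p q r : ℂ) : orientDet q p r = -orientDet p q r := by
  simp only [orientDet, Complex.sub_re, Complex.sub_im]; ring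

theorem orientDet_self_right (p q : ℂ) : orientDet p q q = 0 := by
  simp only [orientDet, Complex.sub_re, Complex.sub_im]; ring

theorem orientDet_self_outer (p q : ℂ) : orientDet p q p = 0 := by
  simp only [orientDet, Complex.sub_re, Complex.sub_im]; ring

theorem orientDet_self_left (p q : ℂ) : orientDet p p q = 0 := by
  simp only [orientDet, Complex.sub_re, Complex.sub_im]; ring

theorem collinear_of_orientDet_eq_zero {p q r : ℂ} (hpq : p ≠ q) (h : orientDet p q r = 0) :
    Collinear ℝ ({p, q, r} : Set ℂ) := by
  rw [collinear_iff_of_mem (p₀ := p) (by simp)]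
  refine ⟨q - p, ?_⟩
  have key : ∃ t : ℝ, r = t • (q - p) +ᵥ p := by
    simp only [orientDet, Complex.sub_re, Complex.sub_im] at h
    by_cases hre : q.re - p.re = 0
    · have him : q.im - p.im ≠ 0 := fun him =>
        hpq (Complex.ext (by linarith) (by linarith))
      refine ⟨(r.im - p.im) / (q.im - p.im), Complex.ext ?_ ?_⟩
      · have : r.re - p.re = 0 := by
          rw [hre] at h
          have : (q.im - p.im) * (r.re - p.re) = 0 := by linarith
          exact (mul_eq_zero.1 this).resolve_left him
        rw [vadd_eq_add, Complex.add_re, Complex.smul_re, Complex.sub_re, hre, smul_zero]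
        linarith
      · rw [vadd_eq_add, Complex.add_im, Complex.smul_im, Complex.sub_im, smul_eq_mul,
          div_mul_cancel₀ _ him, sub_add_cancel]
    · refine ⟨(r.re - p.re) / (q.re - p.re), Complex.ext ?_ ?_⟩
      · rw [vadd_eq_add, Complex.add_re, Complex.smul_re, Complex.sub_re, smul_eq_mul,
          div_mul_cancel₀ _ hre, sub_add_cancel]
      · rw [vadd_eq_add, Complex.add_im, Complex.smul_im, Complex.sub_im, smul_eq_mul,
          div_mul_eq_mul_div, ← sub_eq_iff_eq_add, eq_div_iff hre]
        linarith
  rintro x (rfl | rfl | rfl)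
  · exact ⟨0, by simp⟩
  · exact ⟨1, by simp⟩
  · exact key

theorem InGeneralPosition.orientDet_ne_zero {S : Finset ℂ} (hS : InGeneralPosition S)
    {p q r : ℂ} (hp : p ∈ S) (hq : q ∈ S) (hr : r ∈ S) (hpq : p ≠ q) (hpr : p ≠ r)
    (hqr : q ≠ r) : orientDet p q r ≠ 0 := by
  intro h
  refine hS.1 {p, q, r} ?_ (Finset.card_eq_three.2 ⟨p, q, r, hpq, hpr, hqr, rfl⟩) ?_
  · simp [Finset.insert_subset_iff, hp, hq, hr]
  · simpa using collinear_of_orientDet_eq_zero hpq h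

/-! ### Crossing segments as mutual separation. -/

/-- The points `c` and `d` lie strictly on different sides of the line `ab`. -/
def Separates (a b c d : ℂ) : Prop :=
  orientDet a b c * orientDet a b d < 0

theorem Separates.distinct {a b c d : ℂ} (h : Separates a b c d) :
    a ≠ b ∧ a ≠ c ∧ a ≠ d ∧ b ≠ c ∧ b ≠ d ∧ c ≠ d := by
  unfold Separates at h
  refine ⟨?_, ?_, ?_, ?_, ?_, ?_⟩ <;> rintro rfl
  · simp [orientDet_self_left] at h
  · simp [orientDet_self_outer] at h
  · simp [orientDet_self_outer] at h
  · simp [orientDet_self_right] at h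
  · simp [orientDet_self_right] at h
  · exact absurd h (not_lt.2 (mul_self_nonneg _))

theorem mul_neg_of_convex_combination_eq_zero {x y s t : ℝ} (hs : 0 ≤ s) (ht : 0 ≤ t)
    (hst : s + t = 1) (hx : x ≠ 0) (hy : y ≠ 0) (h : s * x + t * y = 0) : x * y < 0 := by
  by_contra! hxy
  have h1 : s * x ^ 2 + t * (x * y) = 0 := by linear_combination x * h
  have h2 : s * (x * y) + t * y ^ 2 = 0 := by linear_combination y * h
  have hs0 : s * x ^ 2 = 0 := by nlinarith [mul_nonneg hs (sq_nonneg x), mul_nonneg ht hxy]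
  have ht0 : t * y ^ 2 = 0 := by nlinarith [mul_nonneg ht (sq_nonneg y), mul_nonneg hs hxy]
  have hs1 := (mul_eq_zero.1 hs0).resolve_right (pow_ne_zero 2 hx)
  have ht1 := (mul_eq_zero.1 ht0).resolve_right (pow_ne_zero 2 hy)
  linarith

theorem orientDet_combination (a b c d : ℂ) {s t : ℝ} (hst : s + t = 1) :
    orientDet a b (s • c + t • d) = s * orientDet a b c + t * orientDet a b d := by
  obtain rfl : s = 1 - t := by linarith
  simp [orientDet]; ring

theorem InGeneralPosition.edgesCross_pair_iff {S : Finset ℂ} (hS : InGeneralPosition S)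
    {a b c d : ℂ} (ha : a ∈ S) (hb : b ∈ S) (hc : c ∈ S) (hd : d ∈ S) (hab : a ≠ b)
    (hcd : c ≠ d) :
    EdgesCross {a, b} {c, d} ↔ Separates a b c d ∧ Separates c d a b := by
  unfold EdgesCross
  simp only [Finset.coe_pair, convexHull_pair]
  constructor
  · rintro ⟨hdis, x, ⟨s, t, hs, ht, hst, hx⟩, ⟨s', t', hs', ht', hst', hx'⟩⟩
    simp only [Finset.disjoint_insert_left, Finset.disjoint_singleton_left, Finset.mem_insert,
      Finset.mem_singleton, not_or] at hdis
    obtain ⟨⟨hac, had⟩, hbc, hbd⟩ := hdis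
    rw [← Ne.eq_1] at hac had hbc hbd
    constructor
    · refine mul_neg_of_convex_combination_eq_zero hs' ht' hst'
        (hS.orientDet_ne_zero ha hb hc hab hac hbc) (hS.orientDet_ne_zero ha hb hd hab had hbd) ?_
      rw [← orientDet_combination _ _ _ _ hst', hx', ← hx, orientDet_combination _ _ _ _ hst,
        orientDet_self_outer, orientDet_self_right]
      simp
    · refine mul_neg_of_convex_combination_eq_zero hs ht hst
        (hS.orientDet_ne_zero hc hd ha hcd hac.symm had.symm)
        (hS.orientDet_ne_zero hc hd hb hcd hbc.symm hbd.symm) ?_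
      rw [← orientDet_combination _ _ _ _ hst, hx, ← hx', orientDet_combination _ _ _ _ hst',
        orientDet_self_outer, orientDet_self_right]
      simp
  · rintro ⟨h1, h2⟩
    obtain ⟨-, hac, had, hbc, hbd, -⟩ := h1.distinct
    refine ⟨by simp [hac.symm, had.symm, hbc.symm, hbd.symm], ?_⟩
    -- If `x`, `y` are the determinants of two endpoints relative to the other line, these are the
    -- barycentric weights of the intersection point.
    have weights : ∀ x y : ℝ, x * y < 0 →
        0 ≤ -y / (x - y) ∧ 0 ≤ x / (x - y) ∧ -y / (x - y) + x / (x - y) = 1 := by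
      intro x y hxy
      have hne : x - y ≠ 0 := fun h => by
        obtain rfl : x = y := by linarith
        exact absurd hxy (not_lt.2 (mul_self_nonneg _))
      refine ⟨?_, ?_, by field_simp; ring⟩ <;>
      · rcases mul_neg_iff.1 hxy with ⟨h, h'⟩ | ⟨h, h'⟩
        · first
          | exact div_nonneg (by linarith) (by linarith)
        · first
          | exact div_nonneg_of_nonpos (by linarith) (by linarith)
    obtain ⟨w1, w2, w3⟩ := weights _ _ h1
    obtain ⟨v1, v2, v3⟩ := weights _ _ h2
    refine ⟨_, ⟨_, _, v1, v2, v3, rfl⟩, ⟨_, _, w1, w2, w3, ?_⟩⟩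
    have hne : orientDet c d a - orientDet c d b ≠ 0 := fun h => by
      rw [h] at v3; simp at v3
    have hdet : orientDet a b c - orientDet a b d =
        -(orientDet c d a - orientDet c d b) := by
      simp only [orientDet, Complex.sub_re, Complex.sub_im]; ring
    rw [hdet]
    apply Complex.ext <;> simp only [Complex.add_re, Complex.add_im, Complex.real_smul,
      Complex.mul_re, Complex.mul_im, Complex.ofReal_re, Complex.ofReal_im] <;>
      field_simp <;> simp only [orientDet, Complex.sub_re, Complex.sub_im] <;> ring

/-! ### Separations and crossings in a quadruple. -/

open Classical in
/-- The indicator function of `Separates`. -/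
noncomputable def sepInd (a b c d : ℂ) : ℕ :=
  if Separates a b c d then 1 else 0

open Classical in
/-- The indicator that the line `ab` separates `c, d` and the line `cd` separates `a, b`. -/
noncomputable def crossInd (a b c d : ℂ) : ℕ :=
  if Separates a b c d ∧ Separates c d a b then 1 else 0

/-- Four points are pairwise distinct. -/
def Distinct4 (a b c d : ℂ) : Prop :=
  a ≠ b ∧ a ≠ c ∧ a ≠ d ∧ b ≠ c ∧ b ≠ d ∧ c ≠ d

theorem sepInd_eq_zero {a b c d : ℂ} (h : ¬ Distinct4 a b c d) : sepInd a b c d = 0 :=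
  if_neg fun h' => h h'.distinct

theorem crossInd_eq_zero {a b c d : ℂ} (h : ¬ Distinct4 a b c d) : crossInd a b c d = 0 :=
  if_neg fun h' => h h'.1.distinct

open Classical in
theorem InGeneralPosition.sum_sepInd_add_crossInd {S : Finset ℂ} (hS : InGeneralPosition S)
    {a b c d : ℂ} (ha : a ∈ S) (hb : b ∈ S) (hc : c ∈ S) (hd : d ∈ S) :
    (sepInd a b c d + sepInd c d a b + sepInd a c b d + sepInd b d a c + sepInd a d b c
      + sepInd b c a d) + (crossInd a b c d + crossInd a c b d + crossInd a d b c) =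
      3 * if Distinct4 a b c d then 1 else 0 := by
  by_cases h : Distinct4 a b c d
  · obtain ⟨hab, hac, had, hbc, hbd, hcd⟩ := h
    have hA := hS.orientDet_ne_zero hb hc hd hbc hbd hcd
    have hB := hS.orientDet_ne_zero ha hc hd hac had hcd
    have hC := hS.orientDet_ne_zero ha hb hd hab had hbd
    have hD := hS.orientDet_ne_zero ha hb hc hab hac hbc
    -- This relation excludes the two strictly alternating sign patterns; the identity holds for the
    -- other fourteen.
    have hsum : orientDet b c d - orientDet a c d + orientDet a b d - orientDet a b c = 0 := by
      simp only [orientDet, Complex.sub_re, Complex.sub_im]; ring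
    have e1 : orientDet c d a = orientDet a c d := by
      simp only [orientDet, Complex.sub_re, Complex.sub_im]; ring
    have e2 : orientDet c d b = orientDet b c d := by
      simp only [orientDet, Complex.sub_re, Complex.sub_im]; ring
    have e3 : orientDet a c b = -orientDet a b c := by
      simp only [orientDet, Complex.sub_re, Complex.sub_im]; ring
    have e4 : orientDet b d a = orientDet a b d := by
      simp only [orientDet, Complex.sub_re, Complex.sub_im]; ring
    have e5 : orientDet b d c = -orientDet b c d := by
      simp only [orientDet, Complex.sub_re, Complex.sub_im]; ring
    have e6 : orientDet a d b = -orientDet a b d := by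
      simp only [orientDet, Complex.sub_re, Complex.sub_im]; ring
    have e7 : orientDet a d c = -orientDet a c d := by
      simp only [orientDet, Complex.sub_re, Complex.sub_im]; ring
    have e8 : orientDet b c a = orientDet a b c := by
      simp only [orientDet, Complex.sub_re, Complex.sub_im]; ring
    rw [if_pos ⟨hab, hac, had, hbc, hbd, hcd⟩]
    simp only [sepInd, crossInd, Separates, e1, e2, e3, e4, e5, e6, e7, e8]
    clear e1 e2 e3 e4 e5 e6 e7 e8
    rcases lt_or_gt_of_ne hA with hA | hA <;> rcases lt_or_gt_of_ne hB with hB | hB <;>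
    rcases lt_or_gt_of_ne hC with hC | hC <;> rcases lt_or_gt_of_ne hD with hD | hD <;>
    first
    | (exfalso; linarith)
    | simp [mul_neg_iff, mul_pos_iff, hA, hB, hC, hD, not_lt_of_gt]
  · rw [if_neg h, sepInd_eq_zero h, crossInd_eq_zero h, sepInd_eq_zero, sepInd_eq_zero,
      sepInd_eq_zero, sepInd_eq_zero, sepInd_eq_zero, crossInd_eq_zero, crossInd_eq_zero] <;>
    · unfold Distinct4 at *
      tauto

/-! ### Double counting over ordered quadruples. -/

theorem sum_offDiag_pair {β : Type*} [DecidableEq β] (X : Finset β) (f : Finset β → ℕ) :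
    ∑ p ∈ X.offDiag, f {p.1, p.2} = 2 * ∑ T ∈ X.powersetCard 2, f T := by
  rw [← Finset.sum_fiberwise_of_maps_to (s := X.offDiag) (t := X.powersetCard 2)
    (g := fun p => {p.1, p.2}), Finset.mul_sum]
  · refine Finset.sum_congr rfl fun T hT => ?_
    rw [Finset.mem_powersetCard] at hT
    obtain ⟨hTX, hT2⟩ := hT
    obtain ⟨x, y, hxy, rfl⟩ := Finset.card_eq_two.1 hT2
    have hx : x ∈ X := hTX (by simp)
    have hy : y ∈ X := hTX (by simp)
    have : X.offDiag.filter (fun p => ({p.1, p.2} : Finset β) = {x, y}) = {(x, y), (y, x)} := by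
      ext ⟨u, v⟩
      simp only [Finset.mem_filter, Finset.mem_offDiag, Finset.mem_insert, Finset.mem_singleton,
        Prod.mk.injEq]
      constructor
      · rintro ⟨⟨-, -, huv⟩, h⟩
        have hu : u ∈ ({x, y} : Finset β) := h ▸ (by simp)
        have hv : v ∈ ({x, y} : Finset β) := h ▸ (by simp)
        simp only [Finset.mem_insert, Finset.mem_singleton] at hu hv
        grind
      · rintro (⟨rfl, rfl⟩ | ⟨rfl, rfl⟩)
        · exact ⟨⟨hx, hy, hxy⟩, rfl⟩
        · exact ⟨⟨hy, hx, hxy.symm⟩, Finset.pair_comm _ _⟩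
    rw [this, Finset.sum_pair (by simp [hxy]), Finset.pair_comm y x, two_mul]
  · rintro ⟨x, y⟩ h
    rw [Finset.mem_offDiag] at h
    rw [Finset.mem_powersetCard, Finset.card_eq_two]
    exact ⟨by simp [Finset.insert_subset_iff, h.1, h.2.1], x, y, h.2.2, rfl⟩

theorem EdgesCross.symm {e f : Finset ℂ} (h : EdgesCross e f) : EdgesCross f e :=
  ⟨h.1.symm, by rw [Set.inter_comm]; exact h.2⟩

theorem sum_offDiag_eq_sum_sum {β : Type*} [DecidableEq β] (X : Finset β) (f : β → β → ℕ)
    (hf : ∀ x ∈ X, f x x = 0) : ∑ p ∈ X.offDiag, f p.1 p.2 = ∑ x ∈ X, ∑ y ∈ X, f x y := by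
  rw [← Finset.sum_product', ← Finset.diag_union_offDiag,
    Finset.sum_union (Finset.disjoint_diag_offDiag _), Finset.sum_diag,
    Finset.sum_eq_zero hf, zero_add]

-- In `rectilinearCr` the ascription of `P` to `Set` makes the filter run over an elementwise
-- coerced `Finset (Set _)`; injectivity of the coercion preserves the count.
open Classical in
theorem card_filter_coe {β : Type*} (X : Finset (Finset β)) (P : Set β → Prop) :
    ((do let a ← X; pure (a : Set β) : Finset (Set β)).filter P).card =
      (X.filter fun a : Finset β => P a).card := by
  have : (do let a ← X; pure (a : Set β) : Finset (Set β)) =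
      X.image fun a : Finset β => (a : Set β) := by
    ext; simp [Finset.bind_def, eq_comm]
  rw [this, Finset.filter_image, Finset.card_image_of_injective _ Finset.coe_injective]

open Classical in
theorem two_mul_rectilinearCr (S : Finset ℂ) :
    2 * rectilinearCr S = ∑ e ∈ S.powersetCard 2, ∑ f ∈ S.powersetCard 2,
      if EdgesCross e f then 1 else 0 := by
  rw [← sum_offDiag_eq_sum_sum _ fun e f => if EdgesCross e f then 1 else 0]
  · rw [rectilinearCr, card_filter_coe, Finset.card_filter, ← sum_offDiag_pair]
    refine Finset.sum_congr rfl fun p hp => ?_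
    have hne := (Finset.mem_offDiag.1 hp).2.2
    have key : ((({p.1, p.2} : Finset (Finset ℂ)) : Set (Finset ℂ)).Pairwise EdgesCross) ↔
        EdgesCross p.1 p.2 := by
      rw [Finset.coe_pair, Set.pairwise_pair]
      exact ⟨fun h => (h hne).1, fun h _ => ⟨h, h.symm⟩⟩
    simp only [key]
  · intro e he
    refine if_neg fun h => ?_
    have := (Finset.mem_powersetCard.1 he).2
    rw [disjoint_self.1 h.1] at this
    simp at this

-- The factor 8 is two orientations for each edge times two orders of the edges.
open Classical in
theorem InGeneralPosition.sum_crossInd {S : Finset ℂ} (hS : InGeneralPosition S) :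
    ∑ a ∈ S, ∑ b ∈ S, ∑ c ∈ S, ∑ d ∈ S, crossInd a b c d = 8 * rectilinearCr S := by
  have h : ∑ p ∈ S.offDiag, ∑ q ∈ S.offDiag, crossInd p.1 p.2 q.1 q.2 =
      8 * rectilinearCr S := by
    calc _ = ∑ p ∈ S.offDiag, ∑ q ∈ S.offDiag,
          if EdgesCross {p.1, p.2} {q.1, q.2} then 1 else 0 := by
          refine Finset.sum_congr rfl fun p hp => Finset.sum_congr rfl fun q hq => ?_
          rw [Finset.mem_offDiag] at hp hq
          exact if_congr (hS.edgesCross_pair_iff hp.1 hp.2.1 hq.1 hq.2.1 hp.2.2 hq.2.2).symm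
            rfl rfl
      _ = ∑ p ∈ S.offDiag, 2 * ∑ f ∈ S.powersetCard 2,
          if EdgesCross {p.1, p.2} f then 1 else 0 :=
          Finset.sum_congr rfl fun p _ =>
            sum_offDiag_pair S fun f => if EdgesCross {p.1, p.2} f then 1 else 0
      _ = 2 * ∑ e ∈ S.powersetCard 2, 2 * ∑ f ∈ S.powersetCard 2,
          if EdgesCross e f then 1 else 0 :=
          sum_offDiag_pair S fun e => 2 * ∑ f ∈ S.powersetCard 2,
            if EdgesCross e f then 1 else 0
      _ = _ := by rw [← Finset.mul_sum, ← two_mul_rectilinearCr]; ring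
  rw [← h, sum_offDiag_eq_sum_sum S fun a b => ∑ q ∈ S.offDiag, crossInd a b q.1 q.2]
  · refine Finset.sum_congr rfl fun a _ => Finset.sum_congr rfl fun b _ => ?_
    rw [sum_offDiag_eq_sum_sum S fun c d => crossInd a b c d]
    exact fun c _ => crossInd_eq_zero fun h => h.2.2.2.2.2 rfl
  · exact fun a _ => Finset.sum_eq_zero fun q _ => crossInd_eq_zero fun h => h.1 rfl

open Classical in
theorem sum_distinct4 (S : Finset ℂ) :
    ∑ a ∈ S, ∑ b ∈ S, ∑ c ∈ S, ∑ d ∈ S, (if Distinct4 a b c d then 1 else 0) =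
      S.card * ((S.card - 1) * ((S.card - 2) * (S.card - 3))) := by
  have hd : ∀ a ∈ S, ∀ b ∈ S.erase a, ∀ c ∈ (S.erase a).erase b,
      ∑ d ∈ S, (if Distinct4 a b c d then 1 else 0) = S.card - 3 := by
    intro a ha b hb c hc
    rw [← Finset.card_filter]
    have : S.filter (Distinct4 a b c) = ((S.erase a).erase b).erase c := by
      ext d
      simp only [Finset.mem_filter, Finset.mem_erase, Distinct4] at *
      grind
    rw [this, Finset.card_erase_of_mem hc, Finset.card_erase_of_mem hb,
      Finset.card_erase_of_mem ha]
    omega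
  have hc : ∀ a ∈ S, ∀ b ∈ S.erase a,
      ∑ c ∈ S, ∑ d ∈ S, (if Distinct4 a b c d then 1 else 0) =
        (S.card - 2) * (S.card - 3) := by
    intro a ha b hb
    rw [← Finset.sum_subset (s₁ := (S.erase a).erase b), Finset.sum_congr rfl (hd a ha b hb),
      Finset.sum_const, smul_eq_mul, Finset.card_erase_of_mem hb, Finset.card_erase_of_mem ha]
    · rfl
    · exact (Finset.erase_subset _ _).trans (Finset.erase_subset _ _)
    · intro c hcS hcn
      refine Finset.sum_eq_zero fun d _ => if_neg fun h => hcn ?_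
      simp [hcS, h.2.1.symm, h.2.2.2.1.symm]
  have hb : ∀ a ∈ S, ∑ b ∈ S, ∑ c ∈ S, ∑ d ∈ S, (if Distinct4 a b c d then 1 else 0) =
      (S.card - 1) * ((S.card - 2) * (S.card - 3)) := by
    intro a ha
    rw [← Finset.sum_subset (s₁ := S.erase a), Finset.sum_congr rfl (hc a ha),
      Finset.sum_const, smul_eq_mul, Finset.card_erase_of_mem ha]
    · exact Finset.erase_subset _ _
    · intro b hbS hbn
      refine Finset.sum_eq_zero fun c _ => Finset.sum_eq_zero fun d _ => if_neg fun h => hbn ?_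
      simp [hbS, h.1.symm]
  rw [Finset.sum_congr rfl hb, Finset.sum_const, smul_eq_mul]

theorem sum4_swap23 (S : Finset ℂ) (f : ℂ → ℂ → ℂ → ℂ → ℕ) :
    ∑ a ∈ S, ∑ b ∈ S, ∑ c ∈ S, ∑ d ∈ S, f a c b d =
      ∑ a ∈ S, ∑ b ∈ S, ∑ c ∈ S, ∑ d ∈ S, f a b c d :=
  Finset.sum_congr rfl fun _ _ => Finset.sum_comm

theorem sum4_swap34 (S : Finset ℂ) (f : ℂ → ℂ → ℂ → ℂ → ℕ) :
    ∑ a ∈ S, ∑ b ∈ S, ∑ c ∈ S, ∑ d ∈ S, f a b d c =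
      ∑ a ∈ S, ∑ b ∈ S, ∑ c ∈ S, ∑ d ∈ S, f a b c d :=
  Finset.sum_congr rfl fun _ _ => Finset.sum_congr rfl fun _ _ => Finset.sum_comm

theorem sum4_swap12 (S : Finset ℂ) (f : ℂ → ℂ → ℂ → ℂ → ℕ) :
    ∑ a ∈ S, ∑ b ∈ S, ∑ c ∈ S, ∑ d ∈ S, f b a c d =
      ∑ a ∈ S, ∑ b ∈ S, ∑ c ∈ S, ∑ d ∈ S, f a b c d :=
  Finset.sum_comm

theorem InGeneralPosition.sum_sepInd_add_sum_crossInd {S : Finset ℂ}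
    (hS : InGeneralPosition S) :
    6 * ∑ a ∈ S, ∑ b ∈ S, ∑ c ∈ S, ∑ d ∈ S, sepInd a b c d +
      3 * ∑ a ∈ S, ∑ b ∈ S, ∑ c ∈ S, ∑ d ∈ S, crossInd a b c d =
      3 * (S.card * ((S.card - 1) * ((S.card - 2) * (S.card - 3)))) := by
  classical
  have h : ∑ a ∈ S, ∑ b ∈ S, ∑ c ∈ S, ∑ d ∈ S,
      ((sepInd a b c d + sepInd c d a b + sepInd a c b d + sepInd b d a c + sepInd a d b c
      + sepInd b c a d) + (crossInd a b c d + crossInd a c b d + crossInd a d b c)) =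
      ∑ a ∈ S, ∑ b ∈ S, ∑ c ∈ S, ∑ d ∈ S, 3 * (if Distinct4 a b c d then 1 else 0) :=
    Finset.sum_congr rfl fun a ha => Finset.sum_congr rfl fun b hb =>
      Finset.sum_congr rfl fun c hc => Finset.sum_congr rfl fun d hd =>
        hS.sum_sepInd_add_crossInd ha hb hc hd
  simp only [Finset.sum_add_distrib, ← Finset.mul_sum] at h
  rw [sum_distinct4] at h
  have acbd := sum4_swap23 S
  have adbc : ∀ f : ℂ → ℂ → ℂ → ℂ → ℕ, ∑ a ∈ S, ∑ b ∈ S, ∑ c ∈ S, ∑ d ∈ S, f a d b c =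
      ∑ a ∈ S, ∑ b ∈ S, ∑ c ∈ S, ∑ d ∈ S, f a b c d := fun f => by
    rw [sum4_swap34 S fun a b c d => f a c b d, acbd]
  have bcad : ∀ f : ℂ → ℂ → ℂ → ℂ → ℕ, ∑ a ∈ S, ∑ b ∈ S, ∑ c ∈ S, ∑ d ∈ S, f b c a d =
      ∑ a ∈ S, ∑ b ∈ S, ∑ c ∈ S, ∑ d ∈ S, f a b c d := fun f => by
    rw [sum4_swap12 S fun a b c d => f a c b d, acbd]
  have bdac : ∀ f : ℂ → ℂ → ℂ → ℂ → ℕ, ∑ a ∈ S, ∑ b ∈ S, ∑ c ∈ S, ∑ d ∈ S, f b d a c =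
      ∑ a ∈ S, ∑ b ∈ S, ∑ c ∈ S, ∑ d ∈ S, f a b c d := fun f => by
    rw [sum4_swap34 S fun a b c d => f b c a d, bcad]
  have cdab : ∀ f : ℂ → ℂ → ℂ → ℂ → ℕ, ∑ a ∈ S, ∑ b ∈ S, ∑ c ∈ S, ∑ d ∈ S, f c d a b =
      ∑ a ∈ S, ∑ b ∈ S, ∑ c ∈ S, ∑ d ∈ S, f a b c d := fun f => by
    rw [sum4_swap23 S fun a b c d => f b d a c, bdac]
  rw [cdab sepInd, acbd sepInd, bdac sepInd, adbc sepInd, bcad sepInd, acbd crossInd,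
    adbc crossInd] at h
  linarith

/-! ### Products of side counts and the crossing number. -/

open Classical in
/-- The number of points of `S` to the right of the line from `p` to `q`. -/
noncomputable def numRight (S : Finset ℂ) (p q : ℂ) : ℕ :=
  (S.filter fun r => IsRightOf p q r).card

theorem InGeneralPosition.numRight_add_numRight {S : Finset ℂ} (hS : InGeneralPosition S)
    {p q : ℂ} (hp : p ∈ S) (hq : q ∈ S) (hpq : p ≠ q) :
    numRight S p q + numRight S q p = S.card - 2 := by
  classical
  rw [numRight, numRight, ← Finset.card_union_of_disjoint]
  · have : (S.filter fun r => IsRightOf p q r) ∪ (S.filter fun r => IsRightOf q p r) =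
        (S.erase p).erase q := by
      ext r
      simp only [Finset.mem_union, Finset.mem_filter, Finset.mem_erase,
        isRightOf_iff_orientDet_neg, orientDet_swap p q, neg_neg_iff_pos]
      constructor
      · have h1 := orientDet_self_outer p q
        have h2 := orientDet_self_right p q
        rintro (⟨hr, h⟩ | ⟨hr, h⟩)
        · refine ⟨?_, ?_, hr⟩ <;> rintro rfl <;> linarith
        · refine ⟨?_, ?_, hr⟩ <;> rintro rfl <;> linarith
      · rintro ⟨hrq, hrp, hr⟩
        rcases lt_or_gt_of_ne (hS.orientDet_ne_zero hp hq hr hpq hrp.symm hrq.symm) with h | h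
        · exact Or.inl ⟨hr, h⟩
        · exact Or.inr ⟨hr, h⟩
    rw [this, Finset.card_erase_of_mem (by simp [hq, hpq.symm]), Finset.card_erase_of_mem hp]
    omega
  · rw [Finset.disjoint_filter]
    intro r _ h h'
    rw [isRightOf_iff_orientDet_neg] at h h'
    rw [orientDet_swap] at h'
    linarith

/-- A separated ordered pair has one point on each side; the factor 2 is the choice of which comes
first. -/
theorem sum_sepInd_eq (S : Finset ℂ) (a b : ℂ) :
    ∑ c ∈ S, ∑ d ∈ S, sepInd a b c d = 2 * (numRight S a b * numRight S b a) := by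
  classical
  have h : ∀ c d, sepInd a b c d =
      (if IsRightOf a b c then 1 else 0) * (if IsRightOf b a d then 1 else 0) +
      (if IsRightOf b a c then 1 else 0) * (if IsRightOf a b d then 1 else 0) := by
    intro c d
    simp only [sepInd, Separates, isRightOf_iff_orientDet_neg, orientDet_swap a b,
      neg_neg_iff_pos, mul_neg_iff]
    grind
  simp only [h, Finset.sum_add_distrib, ← Finset.sum_mul_sum, ← Finset.card_filter]
  unfold numRight
  ring

theorem InGeneralPosition.sum_numRight_mul {S : Finset ℂ} (hS : InGeneralPosition S) :
    ∑ p ∈ S.offDiag, numRight S p.1 p.2 * numRight S p.2 p.1 + 2 * rectilinearCr S =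
      6 * S.card.choose 4 := by
  have h := hS.sum_sepInd_add_sum_crossInd
  rw [hS.sum_crossInd] at h
  simp only [sum_sepInd_eq, ← Finset.mul_sum] at h
  rw [← sum_offDiag_eq_sum_sum S fun a b => numRight S a b * numRight S b a] at h
  · have hch : S.card * ((S.card - 1) * ((S.card - 2) * (S.card - 3))) =
        24 * S.card.choose 4 := by
      have := Nat.descFactorial_eq_factorial_mul_choose S.card 4
      simp only [Nat.descFactorial, Nat.factorial] at this
      rw [show 24 * S.card.choose 4 = (3 + 1) * ((2 + 1) * ((1 + 1) * ((0 + 1) * 1))) *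
        S.card.choose 4 by ring, ← Nat.succ_eq_add_one 3]
      simp only [Nat.succ_eq_add_one] at *
      rw [← this]
      simp only [Nat.sub_zero]
      ring
    rw [hch] at h
    omega
  · intro a _
    have : numRight S a a = 0 := by
      simp [numRight, isRightOf_iff_orientDet_neg, orientDet_self_left]
    simp [this]

theorem InGeneralPosition.two_mul_sum_numRight {S : Finset ℂ} (hS : InGeneralPosition S) :
    2 * ∑ p ∈ S.offDiag, numRight S p.2 p.1 = S.card * (S.card - 1) * (S.card - 2) := by
  have hswap : ∑ p ∈ S.offDiag, numRight S p.2 p.1 = ∑ p ∈ S.offDiag, numRight S p.1 p.2 :=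
    Finset.sum_equiv (Equiv.prodComm ℂ ℂ)
      (by rintro ⟨a, b⟩; simp [Finset.mem_offDiag, ne_comm]; tauto) (by simp)
  rw [two_mul]
  nth_rw 1 [hswap]
  rw [← Finset.sum_add_distrib, Finset.sum_congr rfl fun p hp =>
    hS.numRight_add_numRight (Finset.mem_offDiag.1 hp).1 (Finset.mem_offDiag.1 hp).2.1
      (Finset.mem_offDiag.1 hp).2.2, Finset.sum_const, Finset.offDiag_card, smul_eq_mul,
    Nat.mul_sub_one]

/-! ### The polynomial and its derivative at 1. -/

theorem numAtMostKEdges_eq_sum (S : Finset ℂ) (k : ℕ) :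
    numAtMostKEdges S k = ∑ p ∈ S.offDiag, if numRight S p.1 p.2 ≤ k then 1 else 0 := by
  classical
  unfold numAtMostKEdges numJEdges
  simp only [Finset.card_filter (p := fun pq : ℂ × ℂ => _ = _)]
  rw [Finset.sum_comm]
  refine Finset.sum_congr rfl fun p _ => ?_
  rw [Finset.sum_ite_eq]
  exact if_congr (by simp [numRight]) rfl rfl

theorem sum_range_ite_le (r l : ℕ) :
    ∑ k ∈ Finset.range (r + l), (if r ≤ k then 1 else 0) = l := by
  rw [Finset.sum_range_add, Finset.sum_eq_zero, Finset.sum_congr rfl fun i _ =>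
    if_pos (Nat.le_add_right r i)]
  · simp
  · intro k hk
    rw [Finset.mem_range] at hk
    exact if_neg (by omega)

theorem two_mul_sum_range_mul_ite_le (r l : ℕ) :
    2 * ∑ k ∈ Finset.range (r + l), k * (if r ≤ k then 1 else 0) = (r + l - 1) * l + r * l := by
  induction l with
  | zero =>
    simp only [add_zero, mul_zero, mul_eq_zero]
    right
    refine Finset.sum_eq_zero fun k hk => ?_
    rw [Finset.mem_range] at hk
    simp [hk]
  | succ l ih =>
    rw [← add_assoc, Finset.sum_range_succ, mul_add, ih, if_pos (by omega)]
    -- The subtraction in `r + l - 1` truncates only when `r = l = 0`.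
    rcases Nat.eq_zero_or_pos (r + l) with h | h
    · obtain ⟨rfl, rfl⟩ : r = 0 ∧ l = 0 := by omega
      simp
    · obtain ⟨m, hm⟩ : ∃ m, r + l = m + 1 := ⟨r + l - 1, by omega⟩
      simp only [hm, Nat.add_sub_cancel]
      nlinarith

theorem InGeneralPosition.sum_numAtMostKEdges {S : Finset ℂ} (hS : InGeneralPosition S) :
    ∑ k ∈ Finset.range (S.card - 2), numAtMostKEdges S k =
      ∑ p ∈ S.offDiag, numRight S p.2 p.1 := by
  simp only [numAtMostKEdges_eq_sum]
  rw [Finset.sum_comm]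
  refine Finset.sum_congr rfl fun p hp => ?_
  rw [Finset.mem_offDiag] at hp
  rw [← hS.numRight_add_numRight hp.1 hp.2.1 hp.2.2, sum_range_ite_le]

theorem InGeneralPosition.two_mul_sum_mul_numAtMostKEdges {S : Finset ℂ}
    (hS : InGeneralPosition S) :
    2 * ∑ k ∈ Finset.range (S.card - 2), k * numAtMostKEdges S k =
      (S.card - 3) * ∑ p ∈ S.offDiag, numRight S p.2 p.1 +
        ∑ p ∈ S.offDiag, numRight S p.1 p.2 * numRight S p.2 p.1 := by
  simp only [numAtMostKEdges_eq_sum, Finset.mul_sum]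
  rw [Finset.sum_comm, ← Finset.sum_add_distrib]
  refine Finset.sum_congr rfl fun p hp => ?_
  rw [Finset.mem_offDiag] at hp
  rw [← Finset.mul_sum, show S.card - 3 = S.card - 2 - 1 by omega,
    ← hS.numRight_add_numRight hp.1 hp.2.1 hp.2.2, two_mul_sum_range_mul_ite_le]

theorem numAtMostKEdges_mono (S : Finset ℂ) : Monotone (numAtMostKEdges S) := fun a b h =>
  Finset.sum_le_sum_of_subset (Finset.range_mono (by omega))

theorem edgePolynomial_coeff (S : Finset ℂ) (k : ℕ) :
    (edgePolynomial S).coeff k =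
      if k < S.card - 2 then (numAtMostKEdges S k : ℂ) else 0 := by
  simp [edgePolynomial, Polynomial.coeff_X_pow]

theorem edgePolynomial_eval_one (S : Finset ℂ) :
    (edgePolynomial S).eval 1 =
      ((∑ k ∈ Finset.range (S.card - 2), numAtMostKEdges S k : ℕ) : ℂ) := by
  simp [edgePolynomial, Polynomial.eval_finsetSum]

theorem edgePolynomial_derivative_eval_one (S : Finset ℂ) :
    (derivative (edgePolynomial S)).eval 1 =
      ((∑ k ∈ Finset.range (S.card - 2), k * numAtMostKEdges S k : ℕ) : ℂ) := by
  simp [edgePolynomial, Polynomial.eval_finsetSum, Polynomial.derivative_X_pow, mul_comm]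

/-! ### Locating a root through the logarithmic derivative. -/

/-- The bound is the value at `z = -r`, the extreme point of the disc; `r ≤ 1` keeps the pole `z =
1` outside. -/
theorem one_div_one_add_lt_re_one_div {z : ℂ} {r : ℝ} (hz : ‖z‖ < r) (hr : r ≤ 1) :
    1 / (1 + r) < (1 / (1 - z)).re := by
  have hsq : z.re ^ 2 + z.im ^ 2 = ‖z‖ ^ 2 := by
    rw [← Complex.normSq_eq_norm_sq, Complex.normSq_apply]; ring
  have h0 := norm_nonneg z
  have hre := Complex.abs_re_le_norm z
  obtain ⟨h1, h2⟩ := abs_le.1 hre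
  rw [one_div (1 - z), Complex.inv_re, Complex.normSq_apply]
  simp only [Complex.sub_re, Complex.one_re, Complex.sub_im, Complex.one_im]
  rw [div_lt_div_iff₀ (by linarith) (by nlinarith [sq_nonneg z.im])]
  nlinarith

/-- If the mean of `1 / (1 - z)` over the roots `z` of a complex polynomial, which is
`p'(1) / (p(1) deg p)`, is real and at most `1 / (1 + r)` with `r ≤ 1`, then `p` has a root of
modulus at least `r`. -/
theorem exists_root_le_norm {p : ℂ[X]} (hdeg : p.natDegree ≠ 0) (h1 : p.eval 1 ≠ 0) {r : ℝ}
    (hr : r ≤ 1)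
    (h : ((derivative p).eval 1 / p.eval 1).re ≤ p.natDegree * (1 / (1 + r))) :
    ∃ z, p.IsRoot z ∧ r ≤ ‖z‖ := by
  by_contra! hcon
  have hp : p ≠ 0 := by rintro rfl; simp at h1
  have hsplit := IsAlgClosed.splits p
  rw [hsplit.eval_derivative_div_eval_of_ne_zero h1] at h
  have hcard : p.roots.card = p.natDegree := hsplit.natDegree_eq_card_roots.symm
  rw [← hcard, ← nsmul_eq_mul, ← Complex.coe_reAddGroupHom, map_multiset_sum,
    Multiset.map_map] at h
  refine absurd h (not_le.2 ?_)
  rw [← Multiset.sum_replicate, ← Multiset.map_const']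
  refine Multiset.sum_lt_sum_of_nonempty ?_ fun z hz =>
    one_div_one_add_lt_re_one_div (hcon z (Polynomial.isRoot_of_mem_roots hz)) hr
  intro h0
  rw [h0] at hcard
  exact hdeg hcard.symm

/-! ### Assembling the bound. -/

theorem mainTheorem4 (n : ℕ) (hn : 3 < n) (S : Finset ℂ) (hcard : S.card = n)
    (hS : InGeneralPosition S) (α : ℝ)
    (hα : (rectilinearCr S : ℝ) = α * (n.choose 4 : ℝ)) :
    ∃ z : ℂ, (edgePolynomial S).IsRoot z ∧ (3 + α) / (9 - α) ≤ ‖z‖ := by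
  have e1 := hS.sum_numAtMostKEdges
  have e2 := hS.two_mul_sum_mul_numAtMostKEdges
  have e3 := hS.two_mul_sum_numRight
  have e4 := hS.sum_numRight_mul
  have v1 := edgePolynomial_eval_one S
  have v2 := edgePolynomial_derivative_eval_one S
  have hcoeff := edgePolynomial_coeff S
  have hmono := numAtMostKEdges_mono S
  rw [hcard] at e1 e2 e3 e4 v1 v2 hcoeff
  rw [← e1] at e2 e3
  obtain ⟨m, rfl⟩ : ∃ m, n = m + 4 := ⟨n - 4, by omega⟩
  have hchoose : (m + 4) * (m + 3) * (m + 2) * (m + 1) = 24 * (m + 4).choose 4 := by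
    have := Nat.descFactorial_eq_factorial_mul_choose (m + 4) 4
    simp only [Nat.descFactorial, Nat.factorial] at this
    simp at this
    linarith
  simp only [show m + 4 - 2 = m + 2 by omega, show m + 4 - 3 = m + 1 by omega,
    show m + 4 - 1 = m + 3 by omega] at *
  set A := ∑ k ∈ Finset.range (m + 2), numAtMostKEdges S k with hA
  set B := ∑ k ∈ Finset.range (m + 2), k * numAtMostKEdges S k
  set R := ∑ p ∈ S.offDiag, numRight S p.1 p.2 * numRight S p.2 p.1
  have hApos : 0 < A := by
    have : 0 < (m + 4) * (m + 3) * (m + 2) := by positivity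
    omega
  -- The coefficients increase, so a vanishing top one would force `A = 0`; the degree is thus
  -- exactly `n - 3`.
  have htop : numAtMostKEdges S (m + 1) ≠ 0 := by
    intro h0
    refine hApos.ne' (Finset.sum_eq_zero fun k hk => ?_)
    have := hmono (show k ≤ m + 1 by rw [Finset.mem_range] at hk; omega)
    omega
  have hdeg : (edgePolynomial S).natDegree = m + 1 := by
    refine Polynomial.natDegree_eq_of_le_of_coeff_ne_zero ?_ ?_
    · rw [Polynomial.natDegree_le_iff_coeff_eq_zero]
      intro k hk
      rw [hcoeff, if_neg (by omega)]
    · rw [hcoeff, if_pos (by omega)]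
      exact_mod_cast htop
  have hC : (0 : ℝ) < (m + 4).choose 4 := by
    exact_mod_cast Nat.choose_pos (by omega)
  have e4' : (R : ℝ) + 2 * (α * (m + 4).choose 4) = 6 * (m + 4).choose 4 := by
    rw [← hα]; exact_mod_cast e4
  -- From `R ≥ 0`; this yields both `9 - α > 0` and a target radius at most 1.
  have hα3 : α ≤ 3 := by
    have hR : (0 : ℝ) ≤ R := Nat.cast_nonneg _
    by_contra! h
    nlinarith
  have hAC : ((m : ℝ) + 1) * A = 12 * (m + 4).choose 4 := by
    have : (m + 1) * A = 12 * (m + 4).choose 4 := by nlinarith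
    exact_mod_cast this
  have hBC : (B : ℝ) = (9 - α) * (m + 4).choose 4 := by
    have : 2 * (B : ℝ) = (m + 1) * A + R := by exact_mod_cast e2
    linarith
  have hAR : (0 : ℝ) < A := by exact_mod_cast hApos
  refine exists_root_le_norm (by omega) ?_ ?_ ?_
  · rw [v1]
    exact_mod_cast hApos.ne'
  · rw [div_le_one (by linarith)]
    linarith
  · have h9 : 9 - α ≠ 0 := by linarith
    have hr : 1 / (1 + (3 + α) / (9 - α)) = (9 - α) / 12 := by
      rw [one_add_div h9, one_div_div]
      ring
    rw [v1, v2, hdeg, hr, ← Complex.ofReal_natCast, ← Complex.ofReal_natCast,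
      ← Complex.ofReal_div, Complex.ofReal_re, div_le_iff₀ hAR, hBC]
    push_cast
    linear_combination -(9 - α) / 12 * hAC
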